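/- Let $(G_1^t)_{t\ge 0}$ be the random multigraph process in which $G_1^0$ is the graph with no vertices and, for $t\ge 1$, $G_1^t$ is obtained from $G_1^{t-1}$ by adding a vertex $v_t$ and a single edge $v_tv_i$, where, given $G_1^{t-1}$, the index $i$ is random with $$\mathbb P(i=s)=\begin{cases}\deg(v_s,t-1)/(2t-1), & 1\le s\le t-1,\\ 1/(2t-1), & s=t,\end{cases}$$ with $\deg(v_s,t-1)$ the degree of $v_s$ in $G_1^{t-1}$ (loops count twice). For $m,n\in\mathbb N$, let the preferential attachment graph $G_m^n$ be obtained from $G_1^{mn}$ by identifying, for each $j=1,\dots,n$, the vertices $v_{(j-1)m+1},\dots,v_{jm}$ to a single vertex, keeping all loops and multiple edges. For a finite multigraph $G$ with vertex set $V(G)$ and at least one edge, let $$q^*(G)=\max_{\mathcal A}\sum_{A\in\mathcal A}\left(\frac{e(A)}{|E(G)|}-\frac{\bigl(\sum_{v\in A}\deg(v)\bigr)^2}{4|E(G)|^2}\right)$$ be its modularity, where $\mathcal A$ ranges over the partitions of $V(G)$, $e(A)$ is the number of edges with both ends in $A$ (with multiplicity, including loops), and loops count twice in $\deg(v)$. **Theorem.**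 For every $\varepsilon>0$, $$\lim_{n\to\infty}\mathbb P\left(q^*(G_2^n)\le \frac{15+\varepsilon}{16}\right)=1,$$ and for every fixed integer $m\ge 3$, $$\lim_{n\to\infty}\mathbb P\left(q^*(G_m^n)\le \frac{15}{16}\right)=1.$$ -/

import Mathlib

open Filter Topology

noncomputable section

/-- A multigraph with vertex set `V` and edge set `E`: every edge has an unordered pair of
endpoints. Loops and parallel edges are allowed. -/
structure Multigraph (V E : Type*) where
  ends : E → Sym2 V

namespace Multigraph

variable {V W E : Type*}

/-- Events are arbitrary sets of multigraphs. -/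
instance : MeasurableSpace (Multigraph V E) := ⊤

/-- The multigraph obtained by applying `f` to all endpoints; vertices with the same image under
`f` are identified. -/
def mapVertices (f : V → W) (G : Multigraph V E) : Multigraph W E where
  ends e := (G.ends e).map f

/-- The degree of `v`: the number of edge-ends at `v`, so that a loop counts twice. -/
def degree [DecidableEq V] [Fintype E] (G : Multigraph V E) (v : V) : ℕ :=
  ∑ e, (G.ends e).toMultiset.count v

/-- The number `e(A)` of edges with both ends in `A` (loops included). -/
def edgesWithin [Fintype E] (G : Multigraph V E) (A : Finset V) : ℕ :=
  Nat.card {e : E // ∀ v ∈ G.ends e, v ∈ A}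

/-- The modularity `q_P(G)` of a partition `P` of the vertex set. -/
def partitionModularity [Fintype V] [DecidableEq V] [Fintype E] (G : Multigraph V E)
    (P : Finpartition (Finset.univ : Finset V)) : ℝ :=
  ∑ A ∈ P.parts, ((G.edgesWithin A : ℝ) / (Fintype.card E : ℝ)
    - (∑ v ∈ A, (G.degree v : ℝ)) ^ 2 / (4 * (Fintype.card E : ℝ) ^ 2))

/-- The modularity `q*(G)`, the maximum of `q_P(G)` over all partitions `P` of the vertex set. -/
def modularity [Fintype V] [DecidableEq V] [Fintype E] (G : Multigraph V E) : ℝ :=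
  ⨆ P : Finpartition (Finset.univ : Finset V), G.partitionModularity P

/-- The supremum in the definition of `modularity` is attained. -/
theorem isGreatest_modularity [Fintype V] [DecidableEq V] [Fintype E] (G : Multigraph V E) :
    IsGreatest (Set.range G.partitionModularity) G.modularity := by
  have hfin : Finite (Finpartition (Finset.univ : Finset V)) := inferInstance
  have hne : Nonempty (Finpartition (Finset.univ : Finset V)) := inferInstance
  refine ⟨?_, ?_⟩
  · obtain ⟨P, hP⟩ := exists_eq_ciSup_of_finite (f := G.partitionModularity)
    exact ⟨P, hP⟩
  · rintro _ ⟨P, rfl⟩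
    exact le_ciSup (Set.finite_range _).bddAbove P

/-- The degrees sum to twice the number of edges. -/
theorem sum_degree [Fintype V] [DecidableEq V] [Fintype E] (G : Multigraph V E) :
    ∑ v, G.degree v = 2 * Fintype.card E := by
  unfold degree
  rw [Finset.sum_comm]
  have h : ∀ e : E, ∑ v, (G.ends e).toMultiset.count v = 2 := fun e => by
    rw [Multiset.sum_count_eq_card (fun a _ => Finset.mem_univ a)]
    exact Sym2.card_toMultiset _
  simp [h, mul_comm]

end Multigraph

namespace PrefAttach

/-- Given `G = G_1^t`, the distribution of the vertex to which the new vertex `v_{t+1}`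
(that is, `Fin.last t`) sends its edge: an old vertex `v_s` is selected with probability
`deg(v_s, t) / (2 (t + 1) - 1)` and `v_{t+1}` itself with probability `1 / (2 (t + 1) - 1)`. -/
def target {t : ℕ} (G : Multigraph (Fin t) (Fin t)) : PMF (Fin (t + 1)) :=
  PMF.ofFintype
    (Fin.lastCases (1 / (2 * t + 1 : ENNReal))
      (fun s => (G.degree s : ENNReal) / (2 * t + 1 : ENNReal))) (by
    rw [Fin.sum_univ_castSucc]
    simp only [Fin.lastCases_castSucc, Fin.lastCases_last]
    simp only [div_eq_mul_inv]
    rw [← Finset.sum_mul, ← add_mul, ← Nat.cast_sum, G.sum_degree]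
    simp only [Fintype.card_fin, Nat.cast_mul, Nat.cast_ofNat]
    exact ENNReal.mul_inv_cancel (by simp) (by finiteness))

/-- Add to `G` a new vertex `Fin.last t` and a new edge from it to `i`. -/
def addEdge {t : ℕ} (G : Multigraph (Fin t) (Fin t)) (i : Fin (t + 1)) :
    Multigraph (Fin (t + 1)) (Fin (t + 1)) where
  ends := Fin.lastCases s(Fin.last t, i) (fun e => (G.ends e).map Fin.castSucc)

/-- The law of `G_1^t`, starting from the null graph; the vertices `v_1, …, v_t` and the edges,
in order of appearance, are indexed by `Fin t`. -/
def treeLaw : (t : ℕ) → PMF (Multigraph (Fin t) (Fin t))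
  | 0 => PMF.pure ⟨Fin.elim0⟩
  | t + 1 => (treeLaw t).bind fun G => (target G).map (addEdge G)

/-- The law of the preferential attachment graph `G_m^n`: in `G_1^{nm}` each of the `n` blocks of
`m` consecutive vertices is identified to a single vertex. -/
def law (m n : ℕ) : PMF (Multigraph (Fin n) (Fin (n * m))) :=
  (treeLaw (n * m)).map (Multigraph.mapVertices Fin.divNat)

/-- The property `Q` holds asymptotically almost surely for `G_m^n` with `m` fixed: its
probability tends to `1` as `n → ∞`. -/
def AAS (m : ℕ) (Q : (n : ℕ) → Multigraph (Fin n) (Fin (n * m)) → Prop) : Prop :=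
  Tendsto (fun n => (law m n).toMeasure {G | Q n G}) atTop (𝓝 1)

end PrefAttach

end

/-! Modularity above `15/16` forces a sparse balanced cut: every part has at most a quarter of the
total degree `2M`, so some union of parts has degree sum between `3M/4` and `5M/4`, with at most
`M/16` edges leaving it (`exists_sparse_cut_of_lt_modularity`).

Such cuts are excluded by a weighted first moment over all two-colourings of the blocks. A
`potential` penalises bichromatic edges and rewards volume; `cutPotential` takes the smaller of the
values for a colouring and its complement, so the relevant class has at most half of the volume. If
that class has a fraction `r ≤ 1/2` of the volume, then up to the drift of `r` within a block the
two extensions by a block multiply the potential on average by `a ^ m` and `b ^ m`, where `a ^ 2 + b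
^ 2 ≤ 1`. Hence for `m ≥ 2` the expected `totalPotential` does not increase once there are 500
blocks (`expect_totalPotential_succ_le`), although the number of colourings doubles.

A sparse balanced cut makes the total at least `(1001/1000) ^ (n * m)` (`pow_le_totalPotential`), so
Markov's inequality gives an exponentially small probability. The bound `15/16` thus holds already
for `m = 2`, with no `ε`. -/

namespace Multigraph

/-! ### Volumes, cuts, and the sparse cut forced by large modularity -/

variable {V W E : Type*}

/-- The number of ends of an edge with colour `true`. -/
def endsIn (c : V → Bool) (z : Sym2 V) : ℕ := z.toMultiset.countP (fun v => c v = true)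

@[simp]
theorem endsIn_mk (c : V → Bool) (a b : V) :
    endsIn c s(a, b) = (if c a then 1 else 0) + (if c b then 1 else 0) := by
  change Multiset.countP _ (a ::ₘ b ::ₘ 0) = _
  simp only [Multiset.countP_cons, Multiset.countP_zero]
  omega

theorem endsIn_map (f : V → W) (c : W → Bool) (z : Sym2 V) :
    endsIn c (z.map f) = endsIn (fun v => c (f v)) z := by
  induction z with | _ a b => simp

theorem endsIn_not (c : V → Bool) (z : Sym2 V) :
    endsIn c z + endsIn (fun v => !c v) z = 2 := by
  induction z with | _ a b => cases ha : c a <;> cases hb : c b <;> simp [ha, hb]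

variable [Fintype E]

/-- The sum of the degrees of the vertices of colour `true`. -/
def volume (c : V → Bool) (G : Multigraph V E) : ℕ := ∑ e, endsIn c (G.ends e)

/-- The number of edges with ends of different colours. -/
def cutSize (c : V → Bool) (G : Multigraph V E) : ℕ :=
  ∑ e, if endsIn c (G.ends e) = 1 then 1 else 0

theorem volume_mapVertices (f : V → W) (c : W → Bool) (G : Multigraph V E) :
    (G.mapVertices f).volume c = G.volume (fun v => c (f v)) := by
  simp [volume, mapVertices, endsIn_map]

theorem cutSize_mapVertices (f : V → W) (c : W → Bool) (G : Multigraph V E) :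
    (G.mapVertices f).cutSize c = G.cutSize (fun v => c (f v)) := by
  simp [cutSize, mapVertices, endsIn_map]

theorem volume_add_volume_not (c : V → Bool) (G : Multigraph V E) :
    G.volume c + G.volume (fun v => !c v) = 2 * Fintype.card E := by
  simp only [volume, ← Finset.sum_add_distrib, endsIn_not]
  simp [mul_comm]

theorem cutSize_not (c : V → Bool) (G : Multigraph V E) :
    G.cutSize (fun v => !c v) = G.cutSize c := by
  unfold cutSize
  refine Finset.sum_congr rfl fun e _ => ?_
  have := endsIn_not c (G.ends e)
  congr 1
  exact propext (by omega)

variable [Fintype V] [DecidableEq V]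

theorem sum_ite_degree (c : V → Bool) (G : Multigraph V E) :
    ∑ v, (if c v then G.degree v else 0) = G.volume c := by
  have key : ∀ s : Multiset V, ∑ v, (if c v then s.count v else 0) = s.countP (fun v => c v) := by
    intro s
    induction s using Multiset.induction with
    | empty => simp
    | cons a s ih =>
      simp only [Multiset.countP_cons, Multiset.count_cons, ← ih]
      have ha : (if c a = true then 1 else 0)
          = ∑ v, if v = a then (if c v = true then 1 else 0) else 0 := by simp
      rw [ha, ← Finset.sum_add_distrib]
      refine Finset.sum_congr rfl fun v _ => ?_
      split_ifs <;> simp_all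
  unfold volume degree endsIn
  simp only [← key]
  rw [Finset.sum_comm]
  refine Finset.sum_congr rfl fun v _ => ?_
  split_ifs <;> simp

theorem sum_degree_eq_volume (A : Finset V) (G : Multigraph V E) :
    ∑ v ∈ A, G.degree v = G.volume (fun v => decide (v ∈ A)) := by
  rw [← sum_ite_degree]
  simp [Finset.sum_ite_mem]

/-- Each edge is counted at most once: it lies within at most one part, and an edge within a part
cannot leave a union of parts. -/
theorem cutSize_biUnion_add_sum_edgesWithin_le (G : Multigraph V E)
    (P : Finpartition (Finset.univ : Finset V)) {B : Finset (Finset V)} (hB : B ⊆ P.parts) :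
    G.cutSize (fun v => decide (v ∈ B.biUnion id)) + ∑ A ∈ P.parts, G.edgesWithin A
      ≤ Fintype.card E := by
  classical
  have hw : ∀ A : Finset V, G.edgesWithin A = ∑ e, if (∀ v ∈ G.ends e, v ∈ A) then 1 else 0 := by
    intro A
    rw [edgesWithin, Nat.card_eq_fintype_card, Fintype.card_subtype, Finset.card_filter]
  simp only [hw]
  rw [Finset.sum_comm, cutSize, ← Finset.sum_add_distrib, Fintype.card_eq_sum_ones]
  refine Finset.sum_le_sum fun e _ => ?_
  generalize G.ends e = z
  induction z with | _ a b =>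
  have huniq : ∀ v : V, ∀ A ∈ P.parts, ∀ A' ∈ P.parts, v ∈ A → v ∈ A' → A = A' :=
    fun v A hA A' hA' h h' => P.disjoint.elim_finset hA hA' v h h'
  by_cases h : ∃ A ∈ P.parts, a ∈ A ∧ b ∈ A
  · obtain ⟨A, hA, ha, hb⟩ := h
    have hS : (a ∈ B.biUnion id) ↔ (b ∈ B.biUnion id) := by
      simp only [Finset.mem_biUnion, id]
      constructor
      · rintro ⟨A', h1, h2⟩
        exact ⟨A', h1, huniq a A hA A' (hB h1) ha h2 ▸ hb⟩
      · rintro ⟨A', h1, h2⟩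
        exact ⟨A', h1, huniq b A hA A' (hB h1) hb h2 ▸ ha⟩
    rw [Finset.sum_eq_single_of_mem A hA]
    · by_cases h' : b ∈ B.biUnion id
      · simp only [endsIn_mk, hS.2 h', h']; simp; split_ifs <;> simp
      · simp only [endsIn_mk, mt hS.1 h', h']; simp; split_ifs <;> simp
    · intro A' hA' hne
      rw [if_neg]
      intro h'
      exact hne (huniq a A' hA' A hA (h' a (by simp)) ha)
  · rw [Finset.sum_eq_zero]
    · split_ifs <;> simp
    · intro A hA
      rw [if_neg]
      intro h'
      exact h ⟨A, hA, h' a (by simp), h' b (by simp)⟩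

/-- A family of weights, none larger than a quarter of the total, has a nearly balanced
subfamily. -/
theorem exists_balanced_subset {ι : Type*} (s : Finset ι) (w : ι → ℕ) (M : ℕ)
    (hsum : ∑ i ∈ s, w i = 2 * M) (hM : 0 < M) (hw : ∀ i ∈ s, 2 * w i ≤ M) :
    ∃ B ⊆ s, 3 * M ≤ 4 * ∑ i ∈ B, w i ∧ 4 * ∑ i ∈ B, w i ≤ 5 * M := by
  classical
  obtain ⟨B, hB, hmax⟩ := Finset.exists_max_image
    (s.powerset.filter fun B => 4 * ∑ i ∈ B, w i ≤ 5 * M) Finset.card ⟨∅, by simp⟩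
  rw [Finset.mem_filter, Finset.mem_powerset] at hB
  refine ⟨B, hB.1, ?_, hB.2⟩
  by_contra! hlt
  obtain ⟨i, his, hiB⟩ : ∃ i ∈ s, i ∉ B := by
    by_contra! hall
    rw [Finset.Subset.antisymm hB.1 hall, hsum] at hlt
    omega
  -- Below `3M/4` there is room for any further weight, since each is at most `M/2`; this
  -- contradicts the maximality of `B`.
  have h1 := hmax (insert i B) (by
    rw [Finset.mem_filter, Finset.mem_powerset]
    refine ⟨Finset.insert_subset his hB.1, ?_⟩
    rw [Finset.sum_insert hiB]
    have := hw i his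
    omega)
  rw [Finset.card_insert_of_notMem hiB] at h1
  omega

/-- A graph of modularity above `15/16` has a balanced cut with few edges. -/
theorem exists_sparse_cut_of_lt_modularity (G : Multigraph V E) (h : 15 / 16 < G.modularity) :
    ∃ S : Finset V, 16 * G.cutSize (fun v => decide (v ∈ S)) ≤ Fintype.card E ∧
      3 * Fintype.card E ≤ 4 * G.volume (fun v => decide (v ∈ S)) ∧
      4 * G.volume (fun v => decide (v ∈ S)) ≤ 5 * Fintype.card E := by
  obtain ⟨P, hP⟩ := G.isGreatest_modularity.1
  rw [← hP] at h
  clear hP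
  unfold partitionModularity at h
  set M := Fintype.card E with hMdef
  rcases Nat.eq_zero_or_pos M with hM0 | hM
  · simp [hM0] at h
    norm_num at h
  have hMR : (0 : ℝ) < M := by exact_mod_cast hM
  have hsum : ∑ A ∈ P.parts, ∑ v ∈ A, G.degree v = 2 * M := by
    rw [← G.sum_degree, ← Finset.sum_biUnion (f := fun v => G.degree v) (t := fun A => A)]
    · exact Finset.sum_congr P.biUnion_parts fun _ _ => rfl
    · exact P.disjoint
  -- The empty union only serves to show that the edge term of the modularity is at most 1, so that
  -- the degree term is below `1/16`.
  have hE := G.cutSize_biUnion_add_sum_edgesWithin_le P (Finset.empty_subset _)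
  have hER : (∑ A ∈ P.parts, (G.edgesWithin A : ℝ)) ≤ M := by
    exact_mod_cast le_trans (Nat.le_add_left _ _) hE
  rw [Finset.sum_sub_distrib, ← Finset.sum_div, ← Finset.sum_div] at h
  have hq : 0 ≤ (∑ A ∈ P.parts, (∑ v ∈ A, (G.degree v : ℝ)) ^ 2) := by positivity
  have h1 : (∑ A ∈ P.parts, (G.edgesWithin A : ℝ)) / M ≤ 1 := (div_le_one hMR).2 hER
  have h2 : (∑ A ∈ P.parts, (∑ v ∈ A, (G.degree v : ℝ)) ^ 2) / (4 * (M : ℝ) ^ 2) < 1 / 16 := by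
    linarith
  have h3 : 15 / 16 < (∑ A ∈ P.parts, (G.edgesWithin A : ℝ)) / M := by
    have : 0 ≤ (∑ A ∈ P.parts, (∑ v ∈ A, (G.degree v : ℝ)) ^ 2) / (4 * (M : ℝ) ^ 2) := by
      positivity
    linarith
  rw [lt_div_iff₀ hMR] at h3
  rw [div_lt_iff₀ (by positivity)] at h2
  have hw : ∀ A ∈ P.parts, 2 * ∑ v ∈ A, G.degree v ≤ M := by
    intro A hA
    have h4 := Finset.single_le_sum
      (f := fun A : Finset V => (∑ v ∈ A, (G.degree v : ℝ)) ^ 2) (fun _ _ => sq_nonneg _) hA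
    have h5 : (2 * ∑ v ∈ A, (G.degree v : ℝ)) ^ 2 ≤ (M : ℝ) ^ 2 := by
      linarith
    exact_mod_cast le_of_sq_le_sq h5 hMR.le
  obtain ⟨B, hB, hB1, hB2⟩ := exists_balanced_subset P.parts _ M hsum hM hw
  have hvol : ∑ A ∈ B, ∑ v ∈ A, G.degree v
      = G.volume (fun v => decide (v ∈ B.biUnion id)) := by
    rw [← sum_degree_eq_volume, Finset.sum_biUnion]
    · rfl
    · exact P.disjoint.subset hB
  rw [hvol] at hB1 hB2
  refine ⟨B.biUnion id, ?_, hB1, hB2⟩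
  have hC := G.cutSize_biUnion_add_sum_edgesWithin_le P hB
  have hCR : (G.cutSize (fun v => decide (v ∈ B.biUnion id)) : ℝ)
      + ∑ A ∈ P.parts, (G.edgesWithin A : ℝ) ≤ M := by exact_mod_cast hC
  have : 16 * (G.cutSize (fun v => decide (v ∈ B.biUnion id)) : ℝ) ≤ M := by linarith
  exact_mod_cast this

end Multigraph

open Multigraph

namespace PrefAttach

/-! ### Volumes and cuts along the process -/

/-- The sum of the degrees of the vertices of colour `true` in a graph of the process. -/
abbrev colourVolume (c : ℕ → Bool) {t : ℕ} (G : Multigraph (Fin t) (Fin t)) : ℕ :=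
  G.volume (fun v : Fin t => c v)

/-- The number of bichromatic edges in a graph of the process. -/
abbrev colourCut (c : ℕ → Bool) {t : ℕ} (G : Multigraph (Fin t) (Fin t)) : ℕ :=
  G.cutSize (fun v : Fin t => c v)

theorem colourVolume_addEdge {t : ℕ} (c : ℕ → Bool) (G : Multigraph (Fin t) (Fin t))
    (i : Fin (t + 1)) :
    colourVolume c (addEdge G i)
      = colourVolume c G + ((if c t then 1 else 0) + if c i then 1 else 0) := by
  simp [colourVolume, volume, addEdge, Fin.sum_univ_castSucc, endsIn_map]

theorem colourCut_addEdge {t : ℕ} (c : ℕ → Bool) (G : Multigraph (Fin t) (Fin t))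
    (i : Fin (t + 1)) :
    colourCut c (addEdge G i) = colourCut c G + if c t = c i then 0 else 1 := by
  simp only [colourCut, cutSize, addEdge, Fin.sum_univ_castSucc, Fin.lastCases_castSucc,
    Fin.lastCases_last, endsIn_map, endsIn_mk, Fin.val_castSucc, Fin.val_last]
  by_cases h : c t = true <;> by_cases h' : c i = true <;> simp [h, h']

theorem colourVolume_add_not {t : ℕ} (c : ℕ → Bool) (G : Multigraph (Fin t) (Fin t)) :
    colourVolume c G + colourVolume (fun v => !c v) G = 2 * t := by
  have := G.volume_add_volume_not (fun v : Fin t => c v)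
  rwa [Fintype.card_fin] at this

/-! ### Expectations -/

/-- A real function of the multigraph at each time. -/
abbrev Observable := (t : ℕ) → Multigraph (Fin t) (Fin t) → ℝ

/-- The conditional expectation of an observable after the next step. -/
noncomputable def step (f : Observable) : Observable := fun t G =>
  ((∑ s : Fin t, (G.degree s : ℝ) * f (t + 1) (addEdge G s.castSucc))
    + f (t + 1) (addEdge G (Fin.last t))) / (2 * t + 1)

/-- The null graph. -/
def emptyGraph : Multigraph (Fin 0) (Fin 0) := ⟨Fin.elim0⟩

/-- The expectation of an observable at time `t`. -/
noncomputable def expect (f : Observable) (t : ℕ) : ℝ := step^[t] f 0 emptyGraph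

theorem step_nonneg {f : Observable} (hf : ∀ t G, 0 ≤ f t G) (t : ℕ)
    (G : Multigraph (Fin t) (Fin t)) : 0 ≤ step f t G := by
  unfold step
  exact div_nonneg (add_nonneg (Finset.sum_nonneg fun s _ =>
    mul_nonneg (Nat.cast_nonneg _) (hf _ _)) (hf _ _)) (by positivity)

theorem step_mono {f g : Observable} {t : ℕ} (h : ∀ G, f (t + 1) G ≤ g (t + 1) G)
    (G : Multigraph (Fin t) (Fin t)) : step f t G ≤ step g t G := by
  unfold step
  gcongr <;> apply h

/-- `step^[k] f t G` is the conditional expectation of `f (t + k)` given `G` at time `t`; thus only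
the values at time `T` matter. -/
theorem iterate_step_mono {f g : Observable} (k : ℕ) {t T : ℕ} (hT : t + k = T)
    (h : ∀ G, f T G ≤ g T G) (G : Multigraph (Fin t) (Fin t)) :
    step^[k] f t G ≤ step^[k] g t G := by
  induction k generalizing t with
  | zero => subst hT; exact h G
  | succ k ih =>
    simp only [Function.iterate_succ_apply']
    exact step_mono (fun G => ih (by omega) G) G

theorem step_finset_sum {ι : Type*} (s : Finset ι) (f : ι → Observable) :
    step (fun t G => ∑ i ∈ s, f i t G) = fun t G => ∑ i ∈ s, step (f i) t G := by
  funext t G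
  simp only [step, ← Finset.sum_div, Finset.sum_add_distrib, Finset.mul_sum]
  rw [Finset.sum_comm]

theorem iterate_step_finset_sum {ι : Type*} (k : ℕ) (s : Finset ι) (f : ι → Observable) :
    step^[k] (fun t G => ∑ i ∈ s, f i t G) = fun t G => ∑ i ∈ s, step^[k] (f i) t G := by
  induction k generalizing f with
  | zero => rfl
  | succ k ih => simp only [Function.iterate_succ_apply, step_finset_sum, ih]

theorem step_const_mul (a : ℝ) (f : Observable) :
    step (fun t G => a * f t G) = fun t G => a * step f t G := by
  funext t G
  simp only [step, mul_left_comm _ a, ← Finset.mul_sum]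
  ring

theorem tsum_bind_mul {α β : Type*} (p : PMF α) (f : α → PMF β) (g : β → ENNReal) :
    ∑' b, p.bind f b * g b = ∑' a, p a * ∑' b, f a b * g b := by
  simp only [PMF.bind_apply, ← ENNReal.tsum_mul_right, ← ENNReal.tsum_mul_left, mul_assoc]
  exact ENNReal.tsum_comm

theorem tsum_map_mul {α β : Type*} (p : PMF α) (f : α → β) (g : β → ENNReal) :
    ∑' b, p.map f b * g b = ∑' a, p a * g (f a) := by
  classical
  rw [PMF.map, tsum_bind_mul]
  simp [PMF.pure_apply, tsum_ite_eq]

theorem tsum_target_mul {f : Observable} (hf : ∀ t G, 0 ≤ f t G) {t : ℕ}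
    (G : Multigraph (Fin t) (Fin t)) :
    ∑' i, target G i * ENNReal.ofReal (f (t + 1) (addEdge G i)) = ENNReal.ofReal (step f t G) := by
  have hpos : (0 : ℝ) < 2 * t + 1 := by positivity
  have hc : (2 * t + 1 : ENNReal) = ENNReal.ofReal (2 * t + 1) := by
    rw [ENNReal.ofReal_add (by positivity) zero_le_one, ENNReal.ofReal_mul zero_le_two]
    simp
  rw [tsum_fintype, Fin.sum_univ_castSucc]
  simp only [target, PMF.ofFintype_apply, Fin.lastCases_castSucc, Fin.lastCases_last]
  unfold step
  have h1 := fun s : Fin t => hf (t + 1) (addEdge G s.castSucc)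
  have h2 := hf (t + 1) (addEdge G (Fin.last t))
  rw [ENNReal.ofReal_div_of_pos hpos, ENNReal.ofReal_add
    (Finset.sum_nonneg fun s _ => mul_nonneg (Nat.cast_nonneg _) (h1 s)) h2,
    ENNReal.ofReal_sum_of_nonneg (fun s _ => mul_nonneg (by positivity) (h1 s)), hc,
    ENNReal.add_div, ENNReal.div_eq_inv_mul (a := ∑ _, _), Finset.mul_sum]
  congr 1
  · refine Finset.sum_congr rfl fun s _ => ?_
    rw [ENNReal.ofReal_mul (by positivity), ENNReal.ofReal_natCast, ENNReal.div_eq_inv_mul,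
      mul_assoc]
  · rw [ENNReal.div_eq_inv_mul, ENNReal.div_eq_inv_mul, mul_one]

/-- Averaging over the last edge replaces `f` by `step f` one time earlier, hence the induction over
all observables. -/
theorem tsum_treeLaw_mul {f : Observable} (hf : ∀ t G, 0 ≤ f t G) (t : ℕ) :
    ∑' G, treeLaw t G * ENNReal.ofReal (f t G) = ENNReal.ofReal (expect f t) := by
  induction t generalizing f with
  | zero =>
    classical
    simp [treeLaw, expect, PMF.pure_apply, emptyGraph]
  | succ t ih =>
    rw [treeLaw, tsum_bind_mul]
    simp only [tsum_map_mul, tsum_target_mul hf]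
    exact ih (step_nonneg hf)

/-- Markov's inequality. -/
theorem treeLaw_toMeasure_le {f : Observable} (hf : ∀ t G, 0 ≤ f t G) (t : ℕ)
    (s : Set (Multigraph (Fin t) (Fin t))) (hs : ∀ G ∈ s, 1 ≤ f t G) :
    (treeLaw t).toMeasure s ≤ ENNReal.ofReal (expect f t) := by
  rw [PMF.toMeasure_apply _ (MeasurableSpace.measurableSet_top), ← tsum_treeLaw_mul hf]
  refine ENNReal.tsum_le_tsum fun G => ?_
  by_cases h : G ∈ s
  · rw [Set.indicator_of_mem h]
    exact le_mul_of_one_le_right' (ENNReal.one_le_ofReal.2 (hs G h))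
  · simp [h]

/-! ### The potential of a colouring -/

/-- With `t` edges, `k` of them bichromatic, and `V` ends of colour `true`, the potential is
`(49/40) ^ t * (1/10) ^ k * (5/4) ^ (V - t)`. -/
noncomputable def potential (c : ℕ → Bool) : Observable := fun t G =>
  (49 / 50) ^ t * (1 / 10) ^ colourCut c G * (5 / 4) ^ colourVolume c G

theorem potential_pos (c : ℕ → Bool) {t : ℕ} (G : Multigraph (Fin t) (Fin t)) :
    0 < potential c t G := by
  unfold potential
  positivity

theorem sum_degree_mul_ite {t : ℕ} (c : ℕ → Bool) (G : Multigraph (Fin t) (Fin t)) (a b : ℝ) :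
    ∑ s : Fin t, (G.degree s : ℝ) * (if c s then a else b)
      = colourVolume c G * a + (2 * t - colourVolume c G) * b := by
  have h1 : ∑ s : Fin t, (G.degree s : ℝ) = 2 * t := by
    have := G.sum_degree
    rw [Fintype.card_fin] at this
    exact_mod_cast this
  have h2 : ∑ s : Fin t, (if c s then (G.degree s : ℝ) else 0) = colourVolume c G := by
    have := G.sum_ite_degree (fun v : Fin t => c v)
    exact_mod_cast this
  rw [← h1, ← h2, sub_mul, Finset.sum_mul, Finset.sum_mul, Finset.sum_mul, add_sub_left_comm,
    ← Finset.sum_sub_distrib, ← Finset.sum_add_distrib]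
  refine Finset.sum_congr rfl fun s _ => ?_
  split_ifs <;> ring

/-- The factors are `49/32 = (49/50) * (5/4) ^ 2` for a monochromatic edge and `49/400 = (49/50) *
(1/10) * (5/4)` for a bichromatic one. The `+ 1` is the weight of a loop at the new vertex. -/
theorem step_potential_of_true {t : ℕ} (c : ℕ → Bool) (hc : c t = true)
    (G : Multigraph (Fin t) (Fin t)) :
    step (potential c) t G = ((colourVolume c G + 1) * (49 / 32)
      + (2 * t - colourVolume c G) * (49 / 400)) / (2 * t + 1) * potential c t G := by
  have h : ∀ i : Fin (t + 1), potential c (t + 1) (addEdge G i)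
      = (if c i then 49 / 32 else 49 / 400) * potential c t G := by
    intro i
    unfold potential
    rw [colourVolume_addEdge, colourCut_addEdge, hc]
    by_cases hi : c i = true <;> simp [hi] <;> ring
  unfold step
  simp only [h, ← mul_assoc, ← Finset.sum_mul, Fin.val_castSucc, Fin.val_last,
    sum_degree_mul_ite, hc, if_true]
  ring

theorem step_potential_of_false {t : ℕ} (c : ℕ → Bool) (hc : c t = false)
    (G : Multigraph (Fin t) (Fin t)) :
    step (potential c) t G = (colourVolume c G * (49 / 400)
      + (2 * t - colourVolume c G + 1) * (49 / 50)) / (2 * t + 1) * potential c t G := by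
  have h : ∀ i : Fin (t + 1), potential c (t + 1) (addEdge G i)
      = (if c i then 49 / 400 else 49 / 50) * potential c t G := by
    intro i
    unfold potential
    rw [colourVolume_addEdge, colourCut_addEdge, hc]
    by_cases hi : c i = true <;> simp [hi] <;> ring
  unfold step
  simp only [h, ← mul_assoc, ← Finset.sum_mul, Fin.val_castSucc, Fin.val_last,
    sum_degree_mul_ite, hc]
  simp
  ring

theorem step_le_mul {f : Observable} {t : ℕ} {G : Multigraph (Fin t) (Fin t)} {a : ℝ}
    {g : Observable} (h : ∀ i, f (t + 1) (addEdge G i) ≤ a * g (t + 1) (addEdge G i)) :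
    step f t G ≤ a * step g t G := by
  rw [← congrFun (congrFun (step_const_mul a g) t) G]
  unfold step
  gcongr <;> apply h

/-- A bound for the growth of the potential during steps of colour `true`. -/
theorem iterate_step_potential_le_of_true (c : ℕ → Bool) {p : ℝ} (hp : 0 ≤ p) (k : ℕ) {t : ℕ}
    (hc : ∀ i, t ≤ i → i < t + k → c i = true) (G : Multigraph (Fin t) (Fin t))
    (hV : (colourVolume c G : ℝ) + 2 * k ≤ p * (2 * t + 1)) :
    step^[k] (potential c) t G ≤ (49 / 400 + p * (49 / 32 - 49 / 400)) ^ k * potential c t G := by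
  induction k generalizing t with
  | zero => simp
  | succ k ih =>
    have hct := hc t le_rfl (by omega)
    rw [Function.iterate_succ_apply', pow_succ, mul_assoc]
    push_cast at hV
    refine (step_le_mul fun i => ih (fun i h1 h2 => hc i (by omega) (by omega)) _ ?_).trans ?_
    -- One step adds at most 2 to the volume, which the term `2 * k` in `hV` has reserved.
    · have : (colourVolume c (addEdge G i) : ℝ) ≤ colourVolume c G + 2 := by
        rw [colourVolume_addEdge]
        push_cast
        split_ifs <;> linarith
      push_cast
      linarith
    · rw [step_potential_of_true c hct]
      refine mul_le_mul_of_nonneg_left (mul_le_mul_of_nonneg_right ?_ (potential_pos c G).le)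
        (pow_nonneg (by linarith) _)
      rw [div_le_iff₀ (by positivity)]
      have : (0 : ℝ) ≤ k := k.cast_nonneg
      linarith

/-- A bound for the growth of the potential during steps of colour `false`. -/
theorem iterate_step_potential_le_of_false (c : ℕ → Bool) {q : ℝ} (hq : q ≤ 1) (k : ℕ)
    {t : ℕ} (hc : ∀ i, t ≤ i → i < t + k → c i = false) (G : Multigraph (Fin t) (Fin t))
    (hV : q * (2 * (t + k) + 1) ≤ colourVolume c G) :
    step^[k] (potential c) t G ≤ (49 / 50 - q * (49 / 50 - 49 / 400)) ^ k * potential c t G := by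
  induction k generalizing t with
  | zero => simp
  | succ k ih =>
    have hct := hc t le_rfl (by omega)
    rw [Function.iterate_succ_apply', pow_succ, mul_assoc]
    push_cast at hV
    refine (step_le_mul fun i => ih (fun i h1 h2 => hc i (by omega) (by omega)) _ ?_).trans ?_
    -- The volume never decreases, and `hV` already compares it with the size at the end of the run.
    · have : (colourVolume c G : ℝ) ≤ colourVolume c (addEdge G i) := by
        rw [colourVolume_addEdge]
        exact_mod_cast Nat.le_add_right _ _
      push_cast
      linarith
    · rw [step_potential_of_false c hct]
      refine mul_le_mul_of_nonneg_left (mul_le_mul_of_nonneg_right ?_ (potential_pos c G).le)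
        (pow_nonneg (by linarith) _)
      rw [div_le_iff₀ (by positivity)]
      have : (0 : ℝ) ≤ k := k.cast_nonneg
      have : q * (2 * t + 1) ≤ colourVolume c G := by
        rcases le_total q 0 with h | h
        · exact (mul_nonpos_of_nonpos_of_nonneg h (by positivity)).trans (Nat.cast_nonneg _)
        · nlinarith
      linarith

/-- One-block growth factors of the two colours add up to at most `1`. -/
theorem growth_pow_add_growth_pow_le_one {m : ℕ} (hm : 2 ≤ m) {r : ℝ} (h0 : 0 ≤ r)
    (h1 : r ≤ 1 / 2) :
    (49 / 400 + (r + 1 / 500) * (49 / 32 - 49 / 400)) ^ m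
      + (49 / 50 - (r - 1 / 500) * (49 / 50 - 49 / 400)) ^ m ≤ (1 : ℝ) := by
  set a : ℝ := 49 / 400 + (r + 1 / 500) * (49 / 32 - 49 / 400) with ha
  set b : ℝ := 49 / 50 - (r - 1 / 500) * (49 / 50 - 49 / 400) with hb
  have ha0 : 0 ≤ a := by rw [ha]; linarith
  have hb0 : 0 ≤ b := by rw [hb]; linarith
  have ha1 : a ≤ 1 := by rw [ha]; linarith
  have hb1 : b ≤ 1 := by rw [hb]; linarith
  -- The left side is a convex quadratic in `r`, below 1 at `r = 0` and `r = 1/2`; the product `r *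
  -- (1/2 - r) ≥ 0` bounds it by its chord.
  have h2 : a ^ 2 + b ^ 2 ≤ 1 := by
    rw [ha, hb]
    nlinarith [mul_nonneg h0 (sub_nonneg.2 h1)]
  linarith [pow_le_pow_of_le_one ha0 ha1 hm, pow_le_pow_of_le_one hb0 hb1 hm]

theorem potential_congr {c d : ℕ → Bool} {t : ℕ} (h : ∀ i < t, c i = d i) :
    potential c t = potential d t := by
  have : (fun v : Fin t => c v) = fun v : Fin t => d v := funext fun v => h v v.2
  funext G
  simp only [potential, colourCut, colourVolume, this]

/-- The two ways to extend a colouring by a block, if `true` has at most half of the volume. -/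
theorem iterate_step_potential_add_le {m : ℕ} (hm : 2 ≤ m) {t : ℕ} (ht : 1000 * m ≤ 2 * t)
    {c d : ℕ → Bool} (hcd : ∀ i < t, c i = d i) (hc : ∀ i, t ≤ i → i < t + m → c i = false)
    (hd : ∀ i, t ≤ i → i < t + m → d i = true) (G : Multigraph (Fin t) (Fin t))
    (hV : colourVolume c G ≤ t) :
    step^[m] (potential c) t G + step^[m] (potential d) t G ≤ potential c t G := by
  have hdc : colourVolume d G = colourVolume c G := by
    have : (fun v : Fin t => d v) = fun v : Fin t => c v := funext fun v => (hcd v v.2).symm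
    simp only [colourVolume, this]
  have hV' : (colourVolume c G : ℝ) ≤ t := by exact_mod_cast hV
  have ht' : 1000 * (m : ℝ) ≤ 2 * t := by exact_mod_cast ht
  have hm' : (0 : ℝ) ≤ m := m.cast_nonneg
  set r : ℝ := colourVolume c G / (2 * t + 1) with hr
  have hr' : r * (2 * t + 1) = colourVolume c G := div_mul_cancel₀ _ (by positivity)
  have hr0 : 0 ≤ r := by positivity
  have hr1 : r ≤ 1 / 2 := by
    rw [hr, div_le_iff₀ (by positivity)]
    linarith
  -- Over a block the degree total grows by `2m ≤ 2t/500`, so a shift of `1/500` absorbs the drift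
  -- of the volume fraction.
  have h1 := iterate_step_potential_le_of_false c (q := r - 1 / 500) (by linarith) m hc G
    (by nlinarith)
  have h2 := iterate_step_potential_le_of_true d (p := r + 1 / 500) (by linarith) m hd G
    (by rw [hdc]; linarith)
  rw [← potential_congr hcd] at h2
  have h3 := mul_le_mul_of_nonneg_right (growth_pow_add_growth_pow_le_one hm hr0 hr1)
    (potential_pos c G).le
  linarith

/-- The potential of the colour class with the smaller potential. -/
noncomputable def cutPotential (c : ℕ → Bool) : Observable := fun t G =>
  min (potential c t G) (potential (fun i => !c i) t G)

theorem cutPotential_pos (c : ℕ → Bool) {t : ℕ} (G : Multigraph (Fin t) (Fin t)) :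
    0 < cutPotential c t G :=
  lt_min (potential_pos c G) (potential_pos _ G)

theorem potential_le_potential_not {t : ℕ} (c : ℕ → Bool) (G : Multigraph (Fin t) (Fin t))
    (h : colourVolume c G ≤ t) : potential c t G ≤ potential (fun i => !c i) t G := by
  have h1 := colourVolume_add_not c G
  have h2 : colourCut (fun i => !c i) G = colourCut c G := cutSize_not _ G
  unfold potential
  rw [h2]
  gcongr
  · norm_num
  · omega

/-- Both extensions are bounded through the colour that is the lighter one at time `t`, even if the
minimum switches during the block. If that colour is `false`, complementing exchanges the roles of
`c` and `d`. -/
theorem iterate_step_cutPotential_add_le {m : ℕ} (hm : 2 ≤ m) {t : ℕ} (ht : 1000 * m ≤ 2 * t)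
    {c d : ℕ → Bool} (hcd : ∀ i < t, c i = d i) (hc : ∀ i, t ≤ i → i < t + m → c i = false)
    (hd : ∀ i, t ≤ i → i < t + m → d i = true) (G : Multigraph (Fin t) (Fin t)) :
    step^[m] (cutPotential c) t G + step^[m] (cutPotential d) t G ≤ cutPotential c t G := by
  rcases le_total (colourVolume c G) t with h | h
  · rw [cutPotential, min_eq_left (potential_le_potential_not c G h)]
    refine le_trans (add_le_add ?_ ?_) (iterate_step_potential_add_le hm ht hcd hc hd G h)
    · exact iterate_step_mono m rfl (fun G => min_le_left _ _) G
    · exact iterate_step_mono m rfl (fun G => min_le_left _ _) G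
  · have h1 := colourVolume_add_not c G
    have h' : colourVolume (fun i => !c i) G ≤ t := by omega
    have h2 := potential_le_potential_not (fun i => !c i) G h'
    simp only [Bool.not_not] at h2
    have hcd' : ∀ i < t, (!d i) = !c i := fun i hi => by rw [hcd i hi]
    have hV : colourVolume (fun i => !d i) G ≤ t := by
      have : (fun v : Fin t => !d v) = fun v : Fin t => !c v := funext fun v => hcd' v v.2
      simpa only [colourVolume, this] using h'
    rw [cutPotential, min_eq_right h2, ← potential_congr hcd', add_comm]
    refine le_trans (add_le_add ?_ ?_) (iterate_step_potential_add_le (d := fun i => !c i) hm ht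
      hcd' (fun i h1 h2 => by simp [hd i h1 h2]) (fun i h1 h2 => by simp [hc i h1 h2]) G hV)
    · exact iterate_step_mono m rfl (fun G => min_le_right _ _) G
    · exact iterate_step_mono m rfl (fun G => min_le_right _ _) G

/-! ### Summation over all cuts -/

/-- The colouring by blocks of length `m`, where the blocks in `T` have colour `true`. -/
def blockColouring (m : ℕ) (T : Finset ℕ) : ℕ → Bool := fun i => decide (i / m ∈ T)

/-- The total potential of all block colourings. -/
noncomputable def totalPotential (m n : ℕ) : Observable := fun t G =>
  ∑ T ∈ (Finset.range n).powerset, cutPotential (blockColouring m T) t G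

theorem expect_totalPotential_succ_le {m : ℕ} (hm : 2 ≤ m) {n : ℕ} (hn : 500 ≤ n) :
    expect (totalPotential m (n + 1)) ((n + 1) * m) ≤ expect (totalPotential m n) (n * m) := by
  unfold expect
  -- The last `m` steps become an inner conditional expectation, to be bounded pointwise at time `n
  -- * m`.
  rw [add_mul, one_mul, Function.iterate_add_apply]
  refine iterate_step_mono (n * m) (zero_add _) (fun G => ?_) _
  have h : totalPotential m (n + 1) = fun t G => ∑ T ∈ (Finset.range (n + 1)).powerset,
      cutPotential (blockColouring m T) t G := rfl
  rw [h, iterate_step_finset_sum]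
  beta_reduce
  -- Each `T` is paired with `insert n T`, the two colourings that extend it to the new block.
  rw [Finset.range_add_one, Finset.sum_powerset_insert Finset.notMem_range_self, ← Finset.sum_add_distrib]
  refine Finset.sum_le_sum fun T hT => ?_
  have hT' : ∀ {i}, n ≤ i → i ∉ T := fun hi h => by
    have := Finset.mem_range.1 (Finset.mem_powerset.1 hT h)
    omega
  have hm0 : 0 < m := by omega
  have hblock : ∀ i, n * m ≤ i → i < n * m + m → i / m = n := fun i h1 h2 =>
    Nat.div_eq_of_lt_le h1 (by rw [add_mul, one_mul]; exact h2)
  refine iterate_step_cutPotential_add_le hm (by nlinarith) (fun i hi => ?_) (fun i h1 h2 => ?_)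
    (fun i h1 h2 => ?_) G
  · have : i / m < n := (Nat.div_lt_iff_lt_mul hm0).2 hi
    simp [blockColouring, this.ne]
  · simpa [blockColouring, hblock i h1 h2] using hT' le_rfl
  · simp [blockColouring, hblock i h1 h2]

theorem expect_totalPotential_le {m : ℕ} (hm : 2 ≤ m) {n : ℕ} (hn : 500 ≤ n) :
    expect (totalPotential m n) (n * m) ≤ expect (totalPotential m 500) (500 * m) := by
  induction n, hn using Nat.le_induction with
  | base => exact le_rfl
  | succ n hn ih => exact (expect_totalPotential_succ_le hm hn).trans ih

/-! ### Sparse balanced cuts have large potential, hence small probability -/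

theorem pow_le_potential {c : ℕ → Bool} {t : ℕ} {G : Multigraph (Fin t) (Fin t)}
    (h1 : 16 * colourCut c G ≤ t) (h2 : 3 * t ≤ 4 * colourVolume c G) :
    (1001 / 1000) ^ t ≤ potential c t G := by
  refine le_of_pow_le_pow_left₀ (n := 16) (by norm_num) (potential_pos c G).le ?_
  calc ((1001 / 1000 : ℝ) ^ t) ^ 16
      = ((1001 / 1000) ^ 16) ^ t := pow_right_comm _ _ _
    -- The 16th power clears the denominators of cut `≤ t/16` and volume `≥ 3t/4`; the base is about
    -- `1.05`, against about `1.016` on the left.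
    _ ≤ ((49 / 50) ^ 16 * (1 / 10) * (5 / 4) ^ 12) ^ t := by gcongr; norm_num
    _ = ((49 / 50) ^ t) ^ 16 * (1 / 10) ^ t * (5 / 4) ^ (4 * (3 * t)) := by
        rw [mul_pow, mul_pow, pow_right_comm, ← pow_mul (5 / 4 : ℝ)]
        congr 2
        ring
    _ ≤ ((49 / 50) ^ t) ^ 16 * (1 / 10) ^ (16 * colourCut c G)
          * (5 / 4) ^ (4 * (4 * colourVolume c G)) := by
        gcongr ?_ * ?_ * ?_
        · exact pow_le_pow_of_le_one (by norm_num) (by norm_num) h1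
        · exact pow_le_pow_right₀ (by norm_num) (by omega)
    _ = potential c t G ^ 16 := by
        unfold potential
        rw [mul_pow, mul_pow, ← pow_mul (1 / 10 : ℝ), ← pow_mul (5 / 4 : ℝ)]
        ring_nf

/-- The volume window is symmetric about `t`, so both colour classes meet the lower bound `3t/4`. -/
theorem pow_le_cutPotential {c : ℕ → Bool} {t : ℕ} {G : Multigraph (Fin t) (Fin t)}
    (h1 : 16 * colourCut c G ≤ t) (h2 : 3 * t ≤ 4 * colourVolume c G)
    (h3 : 4 * colourVolume c G ≤ 5 * t) :
    (1001 / 1000) ^ t ≤ cutPotential c t G := by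
  have h4 := colourVolume_add_not c G
  have h5 : colourCut (fun i => !c i) G = colourCut c G := cutSize_not _ G
  exact le_min (pow_le_potential h1 h2) (pow_le_potential (by omega) (by omega))

theorem pow_le_totalPotential {m n : ℕ} (G : Multigraph (Fin (n * m)) (Fin (n * m)))
    (h : 15 / 16 < (G.mapVertices Fin.divNat).modularity) :
    (1001 / 1000) ^ (n * m) ≤ totalPotential m n (n * m) G := by
  obtain ⟨S, h1, h2, h3⟩ := exists_sparse_cut_of_lt_modularity _ h
  rw [cutSize_mapVertices, Fintype.card_fin] at h1
  rw [volume_mapVertices, Fintype.card_fin] at h2 h3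
  have hS : (fun v : Fin (n * m) => decide (v.divNat ∈ S))
      = fun v : Fin (n * m) => blockColouring m (S.map Fin.valEmbedding) v := by
    funext v
    rw [blockColouring, ← Fin.coe_divNat]
    exact decide_eq_decide.2 (Finset.mem_map' Fin.valEmbedding (a := v.divNat)).symm
  rw [hS] at h1 h2 h3
  refine (pow_le_cutPotential h1 h2 h3).trans
    (Finset.single_le_sum (f := fun T => cutPotential (blockColouring m T) (n * m) G)
      (fun T _ => (cutPotential_pos _ G).le) (Finset.mem_powerset.2 fun i hi => ?_))
  obtain ⟨v, -, rfl⟩ := Finset.mem_map.1 hi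
  exact Finset.mem_range.2 v.2

theorem expect_const_mul (a : ℝ) (f : Observable) (t : ℕ) :
    expect (fun t G => a * f t G) t = a * expect f t := by
  have : ∀ k, step^[k] (fun t G => a * f t G) = fun t G => a * step^[k] f t G := by
    intro k
    induction k with
    | zero => rfl
    | succ k ih => simp only [Function.iterate_succ_apply', ih, step_const_mul]
  exact congrFun (congrFun (this t) 0) emptyGraph

theorem law_toMeasure_lt_modularity_le {m : ℕ} (hm : 2 ≤ m) {n : ℕ} (hn : 500 ≤ n) :
    (law m n).toMeasure {G | 15 / 16 < G.modularity}
      ≤ ENNReal.ofReal ((1000 / 1001) ^ n * expect (totalPotential m 500) (500 * m)) := by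
  have hnn : ∀ t (G : Multigraph (Fin t) (Fin t)), 0 ≤ totalPotential m n t G :=
    fun t G => Finset.sum_nonneg fun T _ => (cutPotential_pos _ G).le
  rw [law, PMF.toMeasure_map_apply _ _ _ measurable_from_top MeasurableSpace.measurableSet_top]
  -- Normalised so that the observable is at least 1 on the bad event, as Markov's inequality
  -- requires.
  refine (treeLaw_toMeasure_le (f := fun t G => (1000 / 1001) ^ (n * m) * totalPotential m n t G)
    (fun t G => mul_nonneg (by positivity) (hnn t G)) _ _ fun G hG => ?_).trans ?_
  · refine le_trans ?_ (mul_le_mul_of_nonneg_left (pow_le_totalPotential G hG) (by positivity))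
    rw [← mul_pow]
    norm_num
  · rw [expect_const_mul]
    refine ENNReal.ofReal_le_ofReal (mul_le_mul ?_ (expect_totalPotential_le hm hn) ?_
      (by positivity))
    · exact pow_le_pow_of_le_one (by norm_num) (by norm_num)
        (Nat.le_mul_of_pos_right n (by omega))
    · have : ∀ k t (G : Multigraph (Fin t) (Fin t)), 0 ≤ step^[k] (totalPotential m n) t G := by
        intro k
        induction k with
        | zero => exact hnn
        | succ k ih => rw [Function.iterate_succ_apply']; exact step_nonneg ih
      exact this _ _ _

theorem aas_modularity_le {m : ℕ} (hm : 2 ≤ m) {q : ℝ} (hq : 15 / 16 ≤ q) :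
    AAS m (fun _ G => G.modularity ≤ q) := by
  have h0 : Tendsto (fun n => (law m n).toMeasure {G | 15 / 16 < G.modularity}) atTop (𝓝 0) := by
    refine tendsto_of_tendsto_of_tendsto_of_le_of_le' tendsto_const_nhds ?_
      (Eventually.of_forall fun n => zero_le)
      (eventually_atTop.2 ⟨500, fun n hn => law_toMeasure_lt_modularity_le hm hn⟩)
    have h1 := (tendsto_pow_atTop_nhds_zero_of_lt_one (r := (1000 / 1001 : ℝ)) (by norm_num)
      (by norm_num)).mul_const (expect (totalPotential m 500) (500 * m))
    rw [zero_mul] at h1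
    simpa using ENNReal.tendsto_ofReal h1
  have h1 := ENNReal.Tendsto.sub (tendsto_const_nhds (x := (1 : ENNReal)) (f := atTop)) h0
    (Or.inl ENNReal.one_ne_top)
  rw [tsub_zero] at h1
  refine tendsto_of_tendsto_of_tendsto_of_le_of_le h1 tendsto_const_nhds (fun n => ?_)
    (fun n => MeasureTheory.prob_le_one)
  rw [← MeasureTheory.prob_compl_eq_one_sub MeasurableSpace.measurableSet_top]
  refine MeasureTheory.measure_mono fun G hG => ?_
  exact (not_lt.1 (Set.notMem_ofPred_iff.1 hG)).trans hq

end PrefAttach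

theorem mainTheorem6 :
    (∀ ε : ℝ, 0 < ε → PrefAttach.AAS 2 (fun _ G => G.modularity ≤ (15 + ε) / 16)) ∧
    (∀ m : ℕ, 3 ≤ m → PrefAttach.AAS m (fun _ G => G.modularity ≤ 15 / 16)) :=
  ⟨fun ε hε => PrefAttach.aas_modularity_le le_rfl (by linarith),
    fun m hm => PrefAttach.aas_modularity_le (by omega) le_rfl⟩
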